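/- For a positive integer $t$ let $\mathrm{rad}(t)$ be the largest squarefree divisor of $t$, and put $\mathrm{rad}_4(t)=\mathrm{rad}(t)$ if $4\nmid t$ and $\mathrm{rad}_4(t)=2\,\mathrm{rad}(t)$ if $4\mid t$. For a prime power $q$ let $N_t(q)$ be the number of irreducible binomials of the form $X^t-a\in\mathbb F_q[X]$ with $a\in\mathbb F_q^*$. Write $\log x=\max\{\ln x,2\}$, where $\ln$ is the natural logarithm. For any fixed $\varepsilon>0$, uniformly over real $Q$ and positive integers $t$ with $\mathrm{rad}_4(t)\le Q^{1-\varepsilon}$, we have $$\sum_{\substack{q\le Q\\ q\text{ a prime power}}}N_t(q)\le(1+o(1))\frac{Q^2}{\mathrm{rad}_4(t)\,\log\bigl(Q/\mathrm{rad}_4(t)\bigr)}\qquad\text{as }Q\to\infty.$$ That is, for all $\varepsilon>0$ and $\delta>0$ there is a $Q_0=Q_0(\varepsilon,\delta)$ such that for all real $Q\ge Q_0$ and all positive integers $t$ with $\mathrm{rad}_4(t)\le Q^{1-\varepsilon}$ the sum on the left is at most $(1+\delta)\,Q^2/\bigl(\mathrm{rad}_4(t)\log(Q/\mathrm{rad}_4(t))\bigr)$.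 -/

import Mathlib

open Polynomial

noncomputable section

namespace IrredBinomials

/-- The truncated logarithm `log x = max {ln x, 2}`. -/
def tlog (x : ℝ) : ℝ := max (Real.log x) 2

/-- `rad₄(t)` is the radical of `t` if `4 ∤ t`, and twice the radical of `t` if `4 ∣ t`. -/
def rad4 (t : ℕ) : ℕ :=
  if 4 ∣ t then 2 * UniqueFactorizationMonoid.radical t
  else UniqueFactorizationMonoid.radical t

/-- The finite field with `q` elements, for a prime power `q`
(the base of `q` is its least prime factor `p`, the exponent is the multiplicity of `p`). -/
def Fq (q : ℕ) (hq : IsPrimePow q) : Type :=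
  haveI : Fact q.minFac.Prime := ⟨Nat.minFac_prime hq.ne_one⟩
  GaloisField q.minFac (q.factorization q.minFac)

instance (q : ℕ) (hq : IsPrimePow q) : Field (Fq q hq) :=
  haveI : Fact q.minFac.Prime := ⟨Nat.minFac_prime hq.ne_one⟩
  inferInstanceAs (Field (GaloisField q.minFac (q.factorization q.minFac)))

theorem card_Fq (q : ℕ) (hq : IsPrimePow q) : Nat.card (Fq q hq) = q := by
  have : Fact q.minFac.Prime := ⟨Nat.minFac_prime hq.ne_one⟩
  have h0 : q.factorization q.minFac ≠ 0 := by
    have h := (Nat.minFac_prime hq.ne_one).factorization_pos_of_dvd hq.ne_zero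
      (Nat.minFac_dvd q)
    omega
  exact (GaloisField.card q.minFac _ h0).trans hq.minFac_pow_factorization_eq

/-- The number of irreducible binomials over `F` of the form `X ^ t - a` (with `a ≠ 0`). -/
def binomialCount (F : Type) [Field F] (t : ℕ) : ℕ :=
  {f : F[X] | (∃ a : F, a ≠ 0 ∧ f = X ^ t - C a) ∧ Irreducible f}.ncard

open Classical in
/-- `N_t(q)`, the number of irreducible binomials `X ^ t - a` over the field with `q` elements.
It is meant for prime powers `q` only, and has the value `0` at all other `q`. -/
def N (t q : ℕ) : ℕ :=
  if hq : IsPrimePow q then binomialCount (Fq q hq) t else 0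

end IrredBinomials

end

/-! ### Selberg sieve weights: the diagonalised quadratic form and the bound by 1. -/

section SelbergWeights

open Finset ArithmeticFunction
open scoped ArithmeticFunction.Moebius

namespace IrredBinomials

/-! Write r = rad₄(t). If X^t - a is irreducible over F_q, then a is not an ℓ-th power for any prime
ℓ dividing t, and if 4 ∣ t then a is not of the form -4b⁴. In a cyclic group F_q^* this forces r ∣ q
- 1 (`rad4_dvd_card_sub_one_of_irreducible`) and leaves at most φ(r)m choices of a when q = rm + 1
(`N_le`). The sum is therefore at most φ(r) times the sum of those m ≤ X = Q/r for which rm + 1 is a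
prime power.

That sum is bounded by a Selberg sieve of level R in which m carries weight m
(`sum_rough_le_selberg`). Its main term is about (X²/2)/G with G the sum of 1/φ(d) over squarefree d
≤ R coprime to r, and G ≥ (φ(r)/r) log(R+1) (`log_le_div_totient_mul_selbergSum`). The factor φ(r)
cancels, which gives uniformity in t. Powers of primes ≤ R are few and are bounded trivially.

With R = X^{1/(2+δ)} the main term is r X²(1 + δ/2)/log X up to a factor tending to 1, and rX² =
Q²/r. The error terms save a power of X, and X ≥ Q^ε tends to infinity uniformly in t. -/

/-- The squarefree integers `d ≤ R` coprime to `r`: the support of the Selberg weights. -/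
def sieveSupport (r R : ℕ) : Finset ℕ :=
  (Icc 1 R).filter fun d => Squarefree d ∧ d.Coprime r

theorem mem_sieveSupport {r R d : ℕ} :
    d ∈ sieveSupport r R ↔ (1 ≤ d ∧ d ≤ R) ∧ Squarefree d ∧ d.Coprime r := by
  simp [sieveSupport]

theorem mem_sieveSupport_of_dvd {r R d e : ℕ} (he : e ∈ sieveSupport r R) (hd : d ∣ e) :
    d ∈ sieveSupport r R := by
  rw [mem_sieveSupport] at he ⊢
  exact ⟨⟨Nat.pos_of_dvd_of_pos hd he.1.1, (Nat.le_of_dvd he.1.1 hd).trans he.1.2⟩,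
    he.2.1.squarefree_of_dvd hd, he.2.2.coprime_dvd_left hd⟩

theorem sieveSupport_filter_dvd {r R f : ℕ} (hf : f ∈ sieveSupport r R) :
    (sieveSupport r R).filter (· ∣ f) = f.divisors := by
  ext d
  have h0 : f ≠ 0 := by rw [mem_sieveSupport] at hf; omega
  simp only [mem_filter, Nat.mem_divisors]
  exact ⟨fun h => ⟨h.2, h0⟩, fun h => ⟨mem_sieveSupport_of_dvd hf h.1, h.1⟩⟩

/-- The Selberg sum `∑ 1 / φ(d)` over `sieveSupport r R`. -/
noncomputable def selbergSum (r R : ℕ) : ℝ :=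
  ∑ d ∈ sieveSupport r R, (1 : ℝ) / d.totient

/-- The optimal Selberg weights. -/
noncomputable def selbergWeight (r R d : ℕ) : ℝ :=
  d * μ d / selbergSum r R * ∑ e ∈ (sieveSupport r R).filter (d ∣ ·), (1 : ℝ) / e.totient

theorem one_mem_sieveSupport {r R : ℕ} (hR : 1 ≤ R) : 1 ∈ sieveSupport r R := by
  simp [mem_sieveSupport, hR]

theorem selbergSum_pos {r R : ℕ} (hR : 1 ≤ R) : 0 < selbergSum r R := by
  refine sum_pos (fun d hd => ?_) ⟨1, one_mem_sieveSupport hR⟩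
  rw [mem_sieveSupport] at hd
  have := Nat.totient_pos.2 hd.1.1
  positivity

theorem selbergWeight_one {r R : ℕ} (hR : 1 ≤ R) : selbergWeight r R 1 = 1 := by
  have := (selbergSum_pos (r := r) hR).ne'
  simp only [selbergWeight, one_dvd, filter_true]
  rw [← selbergSum]
  simp [this]

/-- Put d = ec with c ∣ f/e. Since f is squarefree, c is coprime to e, so μ(e) factors out and the
sum of μ(c) over c ∣ f/e remains. -/
theorem sum_moebius_of_dvd {e f : ℕ} (hf : Squarefree f) (hef : e ∣ f) :
    ∑ d ∈ f.divisors with e ∣ d, (μ d : ℝ) = if e = f then (μ e : ℝ) else 0 := by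
  obtain ⟨k, rfl⟩ := hef
  have h0 := hf.ne_zero
  have he : 0 < e := Nat.pos_of_ne_zero (left_ne_zero_of_mul h0)
  have hk : 0 < k := Nat.pos_of_ne_zero (right_ne_zero_of_mul h0)
  have hcop : e.Coprime k := Nat.coprime_of_squarefree_mul hf
  have himg : (e * k).divisors.filter (e ∣ ·) = k.divisors.image (e * ·) := by
    ext d
    simp only [mem_filter, Nat.mem_divisors, mem_image]
    constructor
    · rintro ⟨⟨h1, -⟩, c, rfl⟩
      exact ⟨c, ⟨Nat.dvd_of_mul_dvd_mul_left he h1, hk.ne'⟩, rfl⟩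
    · rintro ⟨c, ⟨h1, -⟩, rfl⟩
      exact ⟨⟨Nat.mul_dvd_mul_left e h1, h0⟩, dvd_mul_right _ _⟩
  rw [himg, sum_image fun a _ b _ h => Nat.eq_of_mul_eq_mul_left he h]
  have h1 : ∀ c ∈ k.divisors, (μ (e * c) : ℝ) = μ e * μ c := fun c hc => by
    rw [isMultiplicative_moebius.map_mul_of_coprime
      (hcop.coprime_dvd_right (Nat.dvd_of_mem_divisors hc))]
    push_cast; ring
  rw [sum_congr rfl h1, ← mul_sum]
  have h2 : ∑ c ∈ k.divisors, (μ c : ℝ) = if k = 1 then 1 else 0 := by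
    have := congrArg (fun g : ArithmeticFunction ℤ => (g k : ℝ)) moebius_mul_coe_zeta
    simp only [coe_mul_zeta_apply, one_apply] at this
    push_cast at this
    exact this
  rw [h2]
  by_cases hk1 : k = 1
  · simp [hk1]
  · have : e ≠ e * k := fun h => hk1 (Nat.eq_of_mul_eq_mul_left he (by omega))
    simp [hk1, this]

/-- The diagonalised Selberg weights. -/
theorem sum_selbergWeight_div {r R e : ℕ} (he : e ∈ sieveSupport r R) :
    ∑ d ∈ sieveSupport r R with e ∣ d, selbergWeight r R d / d =
      μ e / (e.totient * selbergSum r R) := by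
  have h1 : ∀ d ∈ (sieveSupport r R).filter (e ∣ ·), selbergWeight r R d / d =
      (selbergSum r R)⁻¹ * ∑ f ∈ sieveSupport r R,
        if d ∣ f then (μ d : ℝ) * (1 / f.totient) else 0 := by
    intro d hd
    rw [mem_filter, mem_sieveSupport] at hd
    have hd0 : (d : ℝ) ≠ 0 := by have := hd.1.1.1; positivity
    rw [selbergWeight, ← sum_filter, ← mul_sum]
    field_simp
  rw [sum_congr rfl h1, ← mul_sum, sum_comm]
  -- After the interchange the inner sum is over e ∣ d ∣ f, so Möbius inversion leaves only f = e.
  have h2 : ∀ f ∈ sieveSupport r R, (∑ d ∈ sieveSupport r R with e ∣ d,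
      if d ∣ f then (μ d : ℝ) * (1 / f.totient) else 0) =
      if e = f then (μ e : ℝ) * (1 / e.totient) else 0 := by
    intro f hf
    rw [← sum_filter, ← sum_mul, filter_filter]
    simp_rw [and_comm (a := e ∣ _)]
    rw [← filter_filter, sieveSupport_filter_dvd hf]
    by_cases hef : e ∣ f
    · rw [sum_moebius_of_dvd (mem_sieveSupport.1 hf).2.1 hef]
      split_ifs with h
      · rw [h]
      · simp
    · have h3 : e ≠ f := by rintro rfl; exact hef dvd_rfl
      rw [if_neg h3, filter_eq_empty_iff.2, sum_empty, zero_mul]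
      intro d hd h
      exact hef (h.trans (Nat.dvd_of_mem_divisors hd))
  rw [sum_congr rfl h2, sum_ite_eq, if_pos he]
  rw [one_div, div_eq_mul_inv, mul_inv]
  ring

/-- Since 1/lcm = gcd/(d₁d₂) and gcd is the sum of φ(e) over its divisors e, the variables d₁ and d₂
separate; this turns the sieve's quadratic form into a sum of squares. -/
theorem inv_lcm_eq_sum_totient {r R d₁ d₂ : ℕ} (h₁ : d₁ ∈ sieveSupport r R)
    (h₂ : d₂ ∈ sieveSupport r R) :
    (1 : ℝ) / (d₁.lcm d₂ : ℕ) = ∑ e ∈ sieveSupport r R,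
      e.totient * ((if e ∣ d₁ then (1 : ℝ) / d₁ else 0) * (if e ∣ d₂ then (1 : ℝ) / d₂ else 0)) := by
  have p₁ := (mem_sieveSupport.1 h₁).1.1
  have p₂ := (mem_sieveSupport.1 h₂).1.1
  have hg : d₁.gcd d₂ ∈ sieveSupport r R := mem_sieveSupport_of_dvd h₁ (Nat.gcd_dvd_left _ _)
  have h3 : ∀ e ∈ sieveSupport r R, (e.totient : ℝ) *
      ((if e ∣ d₁ then (1 : ℝ) / d₁ else 0) * (if e ∣ d₂ then (1 : ℝ) / d₂ else 0)) =
      if e ∣ d₁.gcd d₂ then (e.totient : ℝ) * (1 / (d₁ * d₂)) else 0 := by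
    intro e _
    by_cases a : e ∣ d₁ <;> by_cases b : e ∣ d₂ <;> simp [a, b, Nat.dvd_gcd_iff]
    left; ring
  rw [sum_congr rfl h3, ← sum_filter, sieveSupport_filter_dvd hg, ← sum_mul, ← Nat.cast_sum,
    Nat.sum_totient]
  have hl : (0 : ℝ) < (d₁.lcm d₂ : ℕ) := by exact_mod_cast Nat.lcm_pos p₁ p₂
  have hm : ((d₁.gcd d₂ : ℕ) : ℝ) * (d₁.lcm d₂ : ℕ) = d₁ * d₂ := by
    exact_mod_cast Nat.gcd_mul_lcm d₁ d₂
  have : (0 : ℝ) < d₁ * d₂ := by positivity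
  rw [mul_one_div, div_eq_div_iff hl.ne' this.ne']
  linarith

/-- The main term of the Selberg sieve. -/
theorem sum_selbergWeight_mul_inv_lcm {r R : ℕ} (hR : 1 ≤ R) :
    ∑ d₁ ∈ sieveSupport r R, ∑ d₂ ∈ sieveSupport r R,
      selbergWeight r R d₁ * selbergWeight r R d₂ * (1 / (d₁.lcm d₂ : ℕ)) =
      1 / selbergSum r R := by
  have hG := selbergSum_pos (r := r) hR
  have h1 : ∑ d₁ ∈ sieveSupport r R, ∑ d₂ ∈ sieveSupport r R,
      selbergWeight r R d₁ * selbergWeight r R d₂ * (1 / (d₁.lcm d₂ : ℕ)) =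
      ∑ e ∈ sieveSupport r R, (e.totient : ℝ) *
        (∑ d ∈ sieveSupport r R with e ∣ d, selbergWeight r R d / d) ^ 2 := by
    calc _ = ∑ d₁ ∈ sieveSupport r R, ∑ d₂ ∈ sieveSupport r R, ∑ e ∈ sieveSupport r R,
          (e.totient : ℝ) * ((if e ∣ d₁ then selbergWeight r R d₁ / d₁ else 0) *
            (if e ∣ d₂ then selbergWeight r R d₂ / d₂ else 0)) := by
          refine sum_congr rfl fun d₁ h₁ => sum_congr rfl fun d₂ h₂ => ?_
          rw [inv_lcm_eq_sum_totient h₁ h₂, mul_sum]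
          refine sum_congr rfl fun e _ => ?_
          split_ifs <;> ring
      _ = ∑ e ∈ sieveSupport r R, ∑ d₁ ∈ sieveSupport r R, ∑ d₂ ∈ sieveSupport r R,
          (e.totient : ℝ) * ((if e ∣ d₁ then selbergWeight r R d₁ / d₁ else 0) *
            (if e ∣ d₂ then selbergWeight r R d₂ / d₂ else 0)) := by
          symm
          rw [sum_comm]
          exact sum_congr rfl fun d₁ _ => sum_comm
      _ = _ := by
          refine sum_congr rfl fun e _ => ?_
          rw [sum_filter, sq, sum_mul_sum, mul_sum]
          simp_rw [mul_sum]
  rw [h1]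
  have h2 : ∀ e ∈ sieveSupport r R, (e.totient : ℝ) *
      (∑ d ∈ sieveSupport r R with e ∣ d, selbergWeight r R d / d) ^ 2 =
      1 / e.totient * (1 / selbergSum r R ^ 2) := by
    intro e he
    have hs := mem_sieveSupport.1 he
    have hφ : (0 : ℝ) < e.totient := by exact_mod_cast Nat.totient_pos.2 hs.1.1
    have hμ : (μ e : ℝ) ^ 2 = 1 := by
      exact_mod_cast moebius_sq_eq_one_of_squarefree hs.2.1
    rw [sum_selbergWeight_div he, div_pow, hμ]
    field_simp
  rw [sum_congr rfl h2, ← sum_mul, ← selbergSum]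
  field_simp

/-- Expand d as the sum of φ(m) over m ∣ d. For d ∣ f the ratio φ(m)/φ(f) is 1/φ(f/m), and (f, m) ↦
f/m is injective into the support, so the total is at most the Selberg sum. -/
theorem abs_selbergWeight_le_one {r R d : ℕ} (hR : 1 ≤ R) (hd : d ∈ sieveSupport r R) :
    |selbergWeight r R d| ≤ 1 := by
  have hG := selbergSum_pos (r := r) hR
  have hs := mem_sieveSupport.1 hd
  have key : (d : ℝ) * ∑ e ∈ (sieveSupport r R).filter (d ∣ ·), (1 : ℝ) / e.totient ≤
      selbergSum r R := by
    have h1 : (d : ℝ) * ∑ e ∈ (sieveSupport r R).filter (d ∣ ·), (1 : ℝ) / e.totient =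
        ∑ x ∈ (sieveSupport r R).filter (d ∣ ·) ×ˢ d.divisors, (1 : ℝ) / (x.1 / x.2).totient := by
      rw [sum_product, mul_sum]
      refine sum_congr rfl fun f hf => ?_
      rw [mem_filter] at hf
      have hfs := mem_sieveSupport.1 hf.1
      conv_lhs => rw [← Nat.sum_totient d, Nat.cast_sum, sum_mul]
      refine sum_congr rfl fun m hm => ?_
      obtain ⟨k, rfl⟩ := (Nat.dvd_of_mem_divisors hm).trans hf.2
      have hm0 : 0 < m := Nat.pos_of_mem_divisors hm
      have hk0 : 0 < k := Nat.pos_of_ne_zero fun h => by simp [h] at hfs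
      have hφm : (0 : ℝ) < m.totient := by exact_mod_cast Nat.totient_pos.2 hm0
      have hφk : (0 : ℝ) < k.totient := by exact_mod_cast Nat.totient_pos.2 hk0
      rw [Nat.mul_div_cancel_left _ hm0, Nat.totient_mul (Nat.coprime_of_squarefree_mul hfs.2.1)]
      push_cast
      field_simp
    rw [h1]
    have hinj : Set.InjOn (fun x : ℕ × ℕ => x.1 / x.2)
        ((sieveSupport r R).filter (d ∣ ·) ×ˢ d.divisors : Finset (ℕ × ℕ)) := by
      -- As f is squarefree, gcd(f/m, d) = d/m, so f/m determines m and then f.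
      have aux : ∀ f m, f ∈ (sieveSupport r R).filter (d ∣ ·) → m ∈ d.divisors →
          (f / m).gcd d * m = d := by
        intro f m hf hm
        rw [mem_filter] at hf
        have hm0 : 0 < m := Nat.pos_of_mem_divisors hm
        have hfs := (mem_sieveSupport.1 hf.1).2.1
        obtain ⟨k, hk⟩ := Nat.dvd_of_mem_divisors hm
        obtain ⟨l, hl⟩ := hf.2
        rw [hl, hk] at hfs ⊢
        rw [mul_assoc, Nat.mul_div_cancel_left _ hm0]
        rw [mul_assoc] at hfs
        have h3 : m.Coprime l :=
          (Nat.coprime_of_squarefree_mul hfs).coprime_dvd_right (dvd_mul_left _ _)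
        rw [mul_comm m k, Nat.gcd_mul_left, h3.symm.gcd_eq_one, mul_one]
      rintro ⟨f, m⟩ hx ⟨f', m'⟩ hx' heq
      simp only [coe_product, Set.mem_prod, mem_coe] at hx hx' heq
      have e1 := aux f m hx.1 hx.2
      have e2 := aux f' m' hx'.1 hx'.2
      rw [heq] at e1
      have hgpos : 0 < (f' / m').gcd d := Nat.gcd_pos_of_pos_right _ hs.1.1
      have hmm : m = m' := Nat.eq_of_mul_eq_mul_left hgpos (e1.trans e2.symm)
      subst hmm
      have hdf := (Nat.dvd_of_mem_divisors hx.2).trans (mem_filter.1 hx.1).2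
      have hdf' := (Nat.dvd_of_mem_divisors hx.2).trans (mem_filter.1 hx'.1).2
      rw [Nat.div_left_inj hdf hdf'] at heq
      rw [heq]
    rw [selbergSum, ← sum_image (f := fun n : ℕ => (1 : ℝ) / n.totient) hinj]
    refine sum_le_sum_of_subset_of_nonneg ?_ fun _ _ _ => by positivity
    intro n hn
    rw [mem_image] at hn
    obtain ⟨⟨f, m⟩, hx, rfl⟩ := hn
    rw [mem_product, mem_filter] at hx
    exact mem_sieveSupport_of_dvd hx.1.1
      (Nat.div_dvd_of_dvd ((Nat.dvd_of_mem_divisors hx.2).trans hx.1.2))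
  have hμ : |(μ d : ℝ)| ≤ 1 := by exact_mod_cast abs_moebius_le_one
  have hS : 0 ≤ ∑ e ∈ (sieveSupport r R).filter (d ∣ ·), (1 : ℝ) / e.totient :=
    sum_nonneg fun _ _ => by positivity
  rw [selbergWeight, abs_mul, abs_div, abs_mul, abs_of_pos hG, abs_of_nonneg hS, Nat.abs_cast]
  calc _ = |(μ d : ℝ)| * ((d : ℝ) * ∑ e ∈ (sieveSupport r R).filter (d ∣ ·),
          (1 : ℝ) / e.totient) / selbergSum r R := by ring
    _ ≤ 1 * selbergSum r R / selbergSum r R := by gcongr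
    _ = 1 := by field_simp

end IrredBinomials

end SelbergWeights

/-! ### Lower bound for the Selberg sum, and the weighted sieve inequality for rm + 1. -/

section SieveBound

open Finset ArithmeticFunction

namespace IrredBinomials

/-- By the Euler product, n/φ(n) is the full sum of 1/m over all m composed of primes dividing n. -/
theorem sum_inv_le_div_totient {n : ℕ} (hn : n ≠ 0) (s : Finset ℕ)
    (hs : ∀ m ∈ s, m ∈ Nat.factoredNumbers n.primeFactors) :
    ∑ m ∈ s, (1 : ℝ) / m ≤ n / n.totient := by
  let f : ℕ →* ℝ :=
    { toFun := fun m => (m : ℝ)⁻¹, map_one' := by simp, map_mul' := by intro a b; simp [mul_comm] }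
  have hf : ∀ {p : ℕ}, p.Prime → ‖f p‖ < 1 := by
    intro p hp
    have h2 : (1 : ℝ) < p := by exact_mod_cast hp.one_lt
    change ‖(p : ℝ)⁻¹‖ < 1
    rw [norm_inv, RCLike.norm_natCast]
    exact inv_lt_one_of_one_lt₀ h2
  have hsum := (EulerProduct.summable_and_hasSum_factoredNumbers_prod_filter_prime_geometric hf
    n.primeFactors).2
  have hprod : ∏ p ∈ n.primeFactors with p.Prime, (1 - f p)⁻¹ = (n : ℝ) / n.totient := by
    rw [filter_true_of_mem fun p hp => Nat.prime_of_mem_primeFactors hp, prod_inv_distrib]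
    have h1 : (n.totient : ℝ) = n * ∏ p ∈ n.primeFactors, (1 - (p : ℝ)⁻¹) := by
      have h := congrArg (Rat.cast : ℚ → ℝ) (Nat.totient_eq_mul_prod_factors n)
      push_cast at h
      exact h
    have h2 : (n : ℝ) ≠ 0 := by exact_mod_cast hn
    have h3 : (n.totient : ℝ) ≠ 0 := by
      exact_mod_cast (Nat.totient_pos.2 (Nat.pos_of_ne_zero hn)).ne'
    have h4 : ∏ p ∈ n.primeFactors, (1 - (p : ℝ)⁻¹) ≠ 0 := right_ne_zero_of_mul (h1 ▸ h3)
    change (∏ p ∈ n.primeFactors, (1 - (p : ℝ)⁻¹))⁻¹ = _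
    rw [h1]
    field_simp
  classical
  rw [hprod] at hsum
  have h5 := sum_le_hasSum (s.subtype (· ∈ Nat.factoredNumbers n.primeFactors))
    (fun i _ => inv_nonneg.2 (Nat.cast_nonneg _)) hsum
  rw [sum_subtype_of_mem (fun m => f m) hs] at h5
  simpa [f] using h5

/-- The product of the primes that divide `n` but not `r`. -/
def primePart (r n : ℕ) : ℕ := ∏ p ∈ n.primeFactors with ¬p ∣ r, p

theorem primePart_dvd_prod (r n : ℕ) : primePart r n ∣ ∏ p ∈ n.primeFactors, p :=
  prod_dvd_prod_of_subset _ _ _ (filter_subset _ _)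

theorem primePart_dvd (r n : ℕ) : primePart r n ∣ n :=
  (primePart_dvd_prod r n).trans (Nat.prod_primeFactors_dvd n)

theorem primePart_mem_sieveSupport {r R n : ℕ} (hn : 1 ≤ n) (hnR : n ≤ R) :
    primePart r n ∈ sieveSupport r R := by
  have hd := primePart_dvd r n
  rw [mem_sieveSupport]
  refine ⟨⟨Nat.pos_of_dvd_of_pos hd hn, (Nat.le_of_dvd hn hd).trans hnR⟩, ?_, ?_⟩
  · refine Squarefree.squarefree_of_dvd (primePart_dvd_prod r n) ?_
    rw [← Nat.radical_eq_prod_primeFactors]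
    exact UniqueFactorizationMonoid.squarefree_radical
  · refine Nat.Coprime.prod_left fun p hp => ?_
    rw [mem_filter] at hp
    exact (Nat.Prime.coprime_iff_not_dvd (Nat.prime_of_mem_primeFactors hp.1)).2 hp.2

/-- The lower bound for the Selberg sum, uniform in `r`. -/
theorem log_le_div_totient_mul_selbergSum {r R : ℕ} (hr : 0 < r) :
    Real.log (R + 1) ≤ r / r.totient * selbergSum r R := by
  have hφr : (0 : ℝ) < r.totient := by exact_mod_cast Nat.totient_pos.2 hr
  let S : ℕ → Finset ℕ := fun d =>
    (Icc 1 R).filter fun m => m.primeFactors ⊆ (d * r).primeFactors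
  calc Real.log (R + 1) ≤ ∑ n ∈ Icc 1 R, (1 : ℝ) / n := by
        have := log_add_one_le_harmonic R
        rw [harmonic_eq_sum_Icc] at this
        push_cast at this
        simpa using this
    -- Split n as d times a cofactor, with d its squarefree part prime to r; all primes of the
    -- cofactor divide dr.
    _ = ∑ n ∈ Icc 1 R, (1 : ℝ) / primePart r n * (1 / (n / primePart r n : ℕ)) := by
        refine sum_congr rfl fun n _ => ?_
        rw [one_div_mul_one_div, ← Nat.cast_mul, Nat.mul_div_cancel' (primePart_dvd r n)]
    _ ≤ ∑ x ∈ (sieveSupport r R).sigma S, (1 : ℝ) / x.1 * (1 / x.2) := by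
        have hinj : Set.InjOn (fun n : ℕ =>
            (⟨primePart r n, n / primePart r n⟩ : Σ _ : ℕ, ℕ)) (Icc 1 R : Finset ℕ) := by
          intro a _ b _ h
          simp only [Sigma.mk.injEq, heq_eq_eq] at h
          rw [← Nat.mul_div_cancel' (primePart_dvd r a), h.2, h.1,
            Nat.mul_div_cancel' (primePart_dvd r b)]
        rw [← sum_image (f := fun x : Σ _ : ℕ, ℕ => (1 : ℝ) / x.1 * (1 / x.2)) hinj]
        refine sum_le_sum_of_subset_of_nonneg ?_ fun _ _ _ => by positivity
        intro x hx
        rw [mem_image] at hx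
        obtain ⟨n, hn, rfl⟩ := hx
        rw [mem_Icc] at hn
        have hD := primePart_mem_sieveSupport (r := r) hn.1 hn.2
        have hD0 : 0 < primePart r n := (mem_sieveSupport.1 hD).1.1
        have hdvd := Nat.div_dvd_of_dvd (primePart_dvd r n)
        simp only [mem_sigma, S, mem_filter, mem_Icc]
        refine ⟨hD, ⟨Nat.pos_of_dvd_of_pos hdvd hn.1, (Nat.div_le_self _ _).trans hn.2⟩, ?_⟩
        intro p hp
        have hp' := Nat.prime_of_mem_primeFactors hp
        have hpn : p ∣ n := (Nat.dvd_of_mem_primeFactors hp).trans hdvd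
        rw [Nat.mem_primeFactors]
        refine ⟨hp', ?_, (Nat.mul_pos hD0 hr).ne'⟩
        by_cases hpr : p ∣ r
        · exact hpr.mul_left _
        · refine Dvd.dvd.mul_right (dvd_prod_of_mem _ ?_) _
          rw [mem_filter, Nat.mem_primeFactors]
          exact ⟨⟨hp', hpn, by omega⟩, hpr⟩
    _ = ∑ d ∈ sieveSupport r R, (1 : ℝ) / d * ∑ m ∈ S d, (1 : ℝ) / m := by
        rw [sum_sigma]
        simp_rw [mul_sum]
    _ ≤ ∑ d ∈ sieveSupport r R, (1 : ℝ) / d * ((d * r : ℕ) / (d * r : ℕ).totient) := by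
        refine sum_le_sum fun d hd => ?_
        have hd0 := (mem_sieveSupport.1 hd).1.1
        gcongr
        refine sum_inv_le_div_totient (Nat.mul_pos hd0 hr).ne' _ fun m hm => ?_
        simp only [S, mem_filter, mem_Icc] at hm
        exact Nat.mem_factoredNumbers_of_primeFactors_subset (by omega) hm.2
    -- As d and r are coprime, dr/φ(dr) splits, and 1/d times d/φ(d) is the Selberg term 1/φ(d).
    _ = r / r.totient * selbergSum r R := by
        rw [selbergSum, mul_sum]
        refine sum_congr rfl fun d hd => ?_
        have hs := mem_sieveSupport.1 hd
        have hd0 : (0 : ℝ) < d := by exact_mod_cast hs.1.1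
        have hφd : (0 : ℝ) < d.totient := by exact_mod_cast Nat.totient_pos.2 hs.1.1
        rw [Nat.totient_mul hs.2.2]
        push_cast
        field_simp

theorem abs_count_sub_le {d : ℕ} (hd : 0 < d) (c n : ℕ) :
    |(Nat.count (· ≡ c [MOD d]) n : ℝ) - n / d| ≤ 1 := by
  have hd' : (0 : ℝ) < d := by exact_mod_cast hd
  rw [Nat.count_modEq_card n hd]
  have h1 : (n : ℝ) / d = (n / d : ℕ) + (n % d : ℕ) / d := by
    rw [eq_comm, ← sub_eq_zero]
    have : (d : ℝ) * (n / d : ℕ) + (n % d : ℕ) = n := by exact_mod_cast Nat.div_add_mod n d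
    field_simp
    linarith
  have h2 : ((n % d : ℕ) : ℝ) / d ≤ 1 := by
    rw [div_le_one hd']
    exact_mod_cast (Nat.mod_lt n hd).le
  have h3 : 0 ≤ ((n % d : ℕ) : ℝ) / d := by positivity
  rw [h1, abs_le]
  split_ifs <;> push_cast <;> constructor <;> linarith

theorem sum_filter_eq_count (P : ℕ → Prop) [DecidablePred P] (M : ℕ) :
    ∑ m ∈ range (M + 1) with P m, (m : ℝ) =
      M * Nat.count P (M + 1) - ∑ k ∈ range M, (Nat.count P (k + 1) : ℝ) := by
  rw [sum_filter]
  induction M with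
  | zero => simp
  | succ M ih =>
    rw [sum_range_succ, ih, sum_range_succ _ M, Nat.count_succ P (M + 1)]
    split_ifs <;> push_cast <;> ring

/-- Abel summation with counting error at most 1: the boundary term and the summed term each
contribute an error of at most M. -/
theorem abs_sum_filter_modEq_sub_le {d : ℕ} (hd : 0 < d) (c M : ℕ) :
    |∑ m ∈ range (M + 1) with m ≡ c [MOD d], (m : ℝ) - M * (M + 1) / 2 * (1 / d)| ≤ 2 * M := by
  have hd' : (0 : ℝ) < d := by exact_mod_cast hd
  have h1 : ∑ k ∈ range M, (((k + 1 : ℕ) : ℝ) / d) = M * (M + 1) / 2 * (1 / d) := by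
    rw [← sum_div, mul_one_div]
    congr 1
    induction M with
    | zero => simp
    | succ M ih => rw [sum_range_succ, ih]; push_cast; ring
  have h2 : |∑ k ∈ range M, ((Nat.count (· ≡ c [MOD d]) (k + 1) : ℝ) - ((k + 1 : ℕ) : ℝ) / d)|
      ≤ M := by
    refine (abs_sum_le_sum_abs _ _).trans ((sum_le_sum fun k _ => abs_count_sub_le hd c _).trans ?_)
    simp
  have h3 : |(M : ℝ) * ((Nat.count (· ≡ c [MOD d]) (M + 1) : ℝ) - ((M + 1 : ℕ) : ℝ) / d)| ≤ M := by
    rw [abs_mul, Nat.abs_cast]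
    exact mul_le_of_le_one_right (Nat.cast_nonneg _) (abs_count_sub_le hd c _)
  rw [sum_sub_distrib, h1] at h2
  rw [sum_filter_eq_count]
  have h4 : (M : ℝ) * (((M + 1 : ℕ) : ℝ) / d) = 2 * (M * (M + 1) / 2 * (1 / d)) := by
    push_cast; ring
  rw [mul_sub, h4] at h3
  rw [abs_le] at *
  constructor <;> linarith [h2.1, h2.2, h3.1, h3.2]

theorem exists_dvd_mul_add_one_iff_modEq {r d : ℕ} (hd : 0 < d) (h : d.Coprime r) :
    ∃ c, ∀ m, d ∣ r * m + 1 ↔ m ≡ c [MOD d] := by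
  have : NeZero d := ⟨hd.ne'⟩
  refine ⟨(-(r : ZMod d)⁻¹).val, fun m => ?_⟩
  have hu : (r : ZMod d) * (r : ZMod d)⁻¹ = 1 := ZMod.coe_mul_inv_eq_one r h.symm
  rw [← ZMod.natCast_eq_natCast_iff, ← ZMod.natCast_eq_zero_iff, ZMod.natCast_zmod_val]
  push_cast
  constructor
  · intro h1
    linear_combination (r : ZMod d)⁻¹ * h1 - (m : ZMod d) * hu
  · intro h1
    linear_combination (r : ZMod d) * h1 - hu

theorem abs_sum_filter_dvd_sub_le {r d : ℕ} (hd : 0 < d) (h : d.Coprime r) (M : ℕ) :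
    |∑ m ∈ range (M + 1) with d ∣ r * m + 1, (m : ℝ) - M * (M + 1) / 2 * (1 / d)| ≤ 2 * M := by
  obtain ⟨c, hc⟩ := exists_dvd_mul_add_one_iff_modEq hd h
  simp_rw [hc]
  exact abs_sum_filter_modEq_sub_le hd c M

/-- A weighted Brun–Titchmarsh inequality in terms of the Selberg sum. -/
theorem sum_rough_le_selberg {r R : ℕ} (hR : 1 ≤ R) (M : ℕ) (A : Finset ℕ)
    (hA : A ⊆ range (M + 1)) (hrough : ∀ m ∈ A, ∀ p, p.Prime → p ∣ r * m + 1 → R < p) :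
    ∑ m ∈ A, (m : ℝ) ≤ M * (M + 1) / 2 * (1 / selbergSum r R) + 2 * M * R ^ 2 := by
  set D := sieveSupport r R with hD
  set w := selbergWeight r R with hw
  -- Any d > 1 in the support has a prime factor ≤ R, which cannot divide rm + 1; only d = 1 is
  -- left.
  have hone : ∀ m ∈ A, ∑ d ∈ D with d ∣ r * m + 1, w d = 1 := by
    intro m hm
    have : D.filter (· ∣ r * m + 1) = {1} := by
      ext d
      simp only [mem_filter, mem_singleton]
      constructor
      · rintro ⟨h1, h2⟩
        by_contra hne
        have h3 := hrough m hm _ (Nat.minFac_prime hne) ((Nat.minFac_dvd d).trans h2)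
        have h4 := mem_sieveSupport.1 h1
        have h5 := Nat.minFac_le (n := d) h4.1.1
        omega
      · rintro rfl
        exact ⟨one_mem_sieveSupport hR, one_dvd _⟩
    rw [this, sum_singleton, hw, selbergWeight_one hR]
  have hcard : (D.card : ℝ) ≤ R := by
    have : D.card ≤ (Icc 1 R).card := card_filter_le _ _
    rw [Nat.card_Icc] at this
    exact_mod_cast this
  calc ∑ m ∈ A, (m : ℝ) = ∑ m ∈ A, (m : ℝ) * (∑ d ∈ D with d ∣ r * m + 1, w d) ^ 2 := by
        refine sum_congr rfl fun m hm => ?_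
        rw [hone m hm]; ring
    _ ≤ ∑ m ∈ range (M + 1), (m : ℝ) * (∑ d ∈ D with d ∣ r * m + 1, w d) ^ 2 :=
        sum_le_sum_of_subset_of_nonneg hA fun _ _ _ => by positivity
    _ = ∑ m ∈ range (M + 1), ∑ d₁ ∈ D, ∑ d₂ ∈ D,
          w d₁ * w d₂ * (if d₁.lcm d₂ ∣ r * m + 1 then (m : ℝ) else 0) := by
        refine sum_congr rfl fun m _ => ?_
        rw [sum_filter, sq, sum_mul_sum, mul_sum]
        refine sum_congr rfl fun d₁ _ => ?_
        rw [mul_sum]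
        refine sum_congr rfl fun d₂ _ => ?_
        by_cases a : d₁ ∣ r * m + 1 <;> by_cases b : d₂ ∣ r * m + 1 <;>
          simp [a, b, Nat.lcm_dvd_iff]
        ring
    _ = ∑ d₁ ∈ D, ∑ d₂ ∈ D,
          w d₁ * w d₂ * ∑ m ∈ range (M + 1) with d₁.lcm d₂ ∣ r * m + 1, (m : ℝ) := by
        rw [sum_comm]
        refine sum_congr rfl fun d₁ _ => ?_
        rw [sum_comm]
        refine sum_congr rfl fun d₂ _ => ?_
        rw [sum_filter, mul_sum]
    -- Each pair costs an error of at most 2M because the weights are bounded by 1; there are at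
    -- most R² pairs.
    _ ≤ ∑ d₁ ∈ D, ∑ d₂ ∈ D,
          (M * (M + 1) / 2 * (w d₁ * w d₂ * (1 / (d₁.lcm d₂ : ℕ))) + 2 * M) := by
        refine sum_le_sum fun d₁ h₁ => sum_le_sum fun d₂ h₂ => ?_
        have s₁ := mem_sieveSupport.1 h₁
        have s₂ := mem_sieveSupport.1 h₂
        have hcop : (d₁.lcm d₂).Coprime r :=
          (Nat.Coprime.mul_left s₁.2.2 s₂.2.2).coprime_dvd_left (Nat.lcm_dvd_mul _ _)
        have h3 := abs_sum_filter_dvd_sub_le (Nat.lcm_pos s₁.1.1 s₂.1.1) hcop M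
        have h4 : |w d₁ * w d₂| ≤ 1 := by
          rw [abs_mul]
          exact mul_le_one₀ (abs_selbergWeight_le_one hR h₁) (abs_nonneg _)
            (abs_selbergWeight_le_one hR h₂)
        have h5 := (le_abs_self _).trans ((abs_mul (w d₁ * w d₂) _).trans_le
          (mul_le_mul h4 h3 (abs_nonneg _) zero_le_one))
        linarith
    _ = M * (M + 1) / 2 * (1 / selbergSum r R) + 2 * M * (D.card : ℝ) ^ 2 := by
        simp_rw [sum_add_distrib, ← mul_sum]
        rw [sum_selbergWeight_mul_inv_lcm hR]
        simp only [sum_const, nsmul_eq_mul]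
        ring
    _ ≤ _ := by gcongr

end IrredBinomials

end SieveBound

/-! ### Irreducible binomials over finite fields: divisibility of q - 1 and counting. -/

section FiniteFields

open Finset UniqueFactorizationMonoid

namespace IrredBinomials

/-- If ℓ were coprime to the order of the unit group, taking ℓ-th powers would be bijective and a
would be an ℓ-th power. -/
theorem prime_dvd_card_sub_one_of_irreducible {F : Type} [Field F] [Finite F] {t ℓ : ℕ} {a : F}
    (ha : a ≠ 0) (h : Irreducible (X ^ t - C a)) (hℓ : ℓ.Prime) (hℓt : ℓ ∣ t) :
    ℓ ∣ Nat.card F - 1 := by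
  by_contra hnd
  have hcop : (Nat.card Fˣ).Coprime ℓ := by
    rw [Nat.card_units]
    exact ((Nat.Prime.coprime_iff_not_dvd hℓ).2 hnd).symm
  obtain ⟨b, hb⟩ := (powCoprime hcop).surjective (Units.mk0 a ha)
  refine pow_ne_of_irreducible_X_pow_sub_C h hℓt hℓ.ne_one (b : F) ?_
  simpa using congrArg (Units.val) hb

/-- Sophie Germain's factorisation Y⁴ + 4b⁴ = (Y² + 2bY + 2b²)(Y² - 2bY + 2b²) at Y = X^s. -/
theorem not_irreducible_X_pow_add_four_mul {F : Type} [Field F] {s : ℕ} (hs : s ≠ 0) (b : F) :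
    ¬Irreducible (X ^ (4 * s) - C (-(4 * b ^ 4))) := by
  intro h
  have hfac : (X ^ (4 * s) - C (-(4 * b ^ 4)) : F[X]) =
      expand F s (C 1 * X ^ 2 + C (2 * b) * X + C (2 * b ^ 2)) *
      expand F s (C 1 * X ^ 2 + C (-(2 * b)) * X + C (2 * b ^ 2)) := by
    rw [← map_mul]
    have : (C 1 * X ^ 2 + C (2 * b) * X + C (2 * b ^ 2)) *
        (C 1 * X ^ 2 + C (-(2 * b)) * X + C (2 * b ^ 2)) = X ^ 4 + C (4 * b ^ 4) := by
      simp only [C_mul, C_neg, C_pow, C_1, map_ofNat]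
      ring
    rw [this]
    simp [← pow_mul, mul_comm]
  have hdeg : ∀ c : F, ¬IsUnit (expand F s (C 1 * X ^ 2 + C c * X + C (2 * b ^ 2))) := by
    intro c hu
    have h1 := natDegree_eq_zero_of_isUnit hu
    rw [natDegree_expand, natDegree_quadratic one_ne_zero] at h1
    omega
  rcases h.isUnit_or_isUnit hfac with hu | hu
  · exact hdeg _ hu
  · exact hdeg _ hu

/-- Otherwise q - 1 = 2k with k odd. As a is not a square, a^k = -1, hence (-a/4)^k = 1. An element
of odd order is a fourth power, so a = -4b⁴ and the binomial factors. -/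
theorem four_dvd_card_sub_one_of_irreducible {F : Type} [Field F] [Finite F] {t : ℕ} {a : F}
    (ha : a ≠ 0) (h : Irreducible (X ^ t - C a)) (ht : 4 ∣ t) : 4 ∣ Nat.card F - 1 := by
  have ht0 : t ≠ 0 := ne_zero_of_irreducible_X_pow_sub_C h
  have h2t : 2 ∣ t := dvd_trans (by norm_num) ht
  obtain ⟨k, hk⟩ := prime_dvd_card_sub_one_of_irreducible ha h Nat.prime_two h2t
  by_contra h4
  have hodd : k % 2 = 1 := by omega
  have hfermat : ∀ x : F, x ≠ 0 → x ^ (2 * k) = 1 := by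
    intro x hx
    rw [← hk, ← Nat.card_units]
    have := congrArg Units.val (pow_card_eq_one' (x := Units.mk0 x hx))
    rwa [Units.val_pow_eq_pow_val, Units.val_mk0, Units.val_one] at this
  have hneg : a ^ k = -1 := by
    have h1 : (a ^ k - 1) * (a ^ k + 1) = 0 := by
      have := hfermat a ha
      rw [mul_comm 2 k, pow_mul] at this
      linear_combination this
    rcases mul_eq_zero.1 h1 with h1 | h1
    · exfalso
      refine pow_ne_of_irreducible_X_pow_sub_C h h2t (by norm_num) (a ^ ((k + 1) / 2)) ?_
      rw [← pow_mul, show (k + 1) / 2 * 2 = k + 1 by omega, pow_succ, sub_eq_zero.1 h1, one_mul]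
    · exact eq_neg_of_add_eq_zero_left h1
  have htwo : (2 : F) ≠ 0 := by
    intro h2
    have h1 : (1 : F) = -1 := by linear_combination h2
    refine pow_ne_of_irreducible_X_pow_sub_C h h2t (by norm_num) (a ^ ((k + 1) / 2)) ?_
    rw [← pow_mul, show (k + 1) / 2 * 2 = k + 1 by omega, pow_succ, hneg, ← h1, one_mul]
  have hfour : (4 : F) ^ k = 1 := by
    rw [show (4 : F) = 2 ^ 2 by norm_num, ← pow_mul]
    exact hfermat 2 htwo
  have hfour0 : (4 : F) ≠ 0 := by
    rw [show (4 : F) = 2 ^ 2 by norm_num]; exact pow_ne_zero 2 htwo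
  have hc : (-a / 4) ^ k = 1 := by
    rw [div_pow, hfour, div_one, Odd.neg_pow (Nat.odd_iff.2 hodd), hneg, neg_neg]
  -- The exponent of the witness inverts 4 modulo k: it is (k+1)/4 or (3k+1)/4 according to k mod 4.
  obtain ⟨b, hb⟩ : ∃ b : F, b ^ 4 = -a / 4 := by
    rcases (by omega : k % 4 = 3 ∨ k % 4 = 1) with h3 | h3
    · refine ⟨(-a / 4) ^ ((k + 1) / 4), ?_⟩
      rw [← pow_mul, show (k + 1) / 4 * 4 = k + 1 by omega, pow_succ, hc, one_mul]
    · refine ⟨(-a / 4) ^ ((k * 3 + 1) / 4), ?_⟩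
      rw [← pow_mul, show (k * 3 + 1) / 4 * 4 = k * 3 + 1 by omega, pow_succ, pow_mul, hc,
        one_pow, one_mul]
  obtain ⟨s, rfl⟩ := ht
  have hab : a = -(4 * b ^ 4) := by rw [hb]; field_simp
  rw [hab] at h
  exact not_irreducible_X_pow_add_four_mul (by omega) b h

theorem rad4_dvd_card_sub_one_of_irreducible {F : Type} [Field F] [Finite F] {t : ℕ} {a : F}
    (ha : a ≠ 0) (h : Irreducible (X ^ t - C a)) : rad4 t ∣ Nat.card F - 1 := by
  have ht0 : t ≠ 0 := ne_zero_of_irreducible_X_pow_sub_C h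
  have hq : Nat.card F - 1 ≠ 0 := by
    have := Finite.one_lt_card (α := F)
    omega
  have hrad : radical t ∣ Nat.card F - 1 := by
    rw [Nat.radical_dvd_iff hq]
    intro p hp
    rw [Nat.mem_primeFactors] at hp ⊢
    exact ⟨hp.1, prime_dvd_card_sub_one_of_irreducible ha h hp.1 hp.2.1, hq⟩
  unfold rad4
  split_ifs with h4
  · have h4q := four_dvd_card_sub_one_of_irreducible ha h h4
    obtain ⟨k, hk⟩ : 2 ∣ radical t :=
      (dvd_radical_iff_of_irreducible Nat.prime_two ht0).2 (dvd_trans (by norm_num) h4)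
    have hsq : Squarefree (2 * k) := hk ▸ squarefree_radical
    have hcop : Nat.Coprime 2 k := Nat.coprime_of_squarefree_mul hsq
    -- Here rad(t) = 2k with k odd, so 2 rad(t) = 4k and the coprime factors 4 and k are handled
    -- separately.
    rw [hk, ← mul_assoc]
    refine Nat.Coprime.mul_dvd_of_dvd_of_dvd (hcop.pow_left 2) h4q ?_
    exact (Dvd.intro_left 2 hk.symm).trans hrad
  · exact hrad

theorem card_filter_coprime_range_mul (s k : ℕ) :
    ((range (s * k)).filter fun i => s.Coprime i).card = s.totient * k := by
  induction k with
  | zero => simp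
  | succ k ih =>
    have h1 : range (s * (k + 1)) = range (s * k) ∪ Ico (s * k) (s * k + s) := by
      ext i; simp only [mem_range, mem_union, mem_Ico, mul_add, mul_one]; omega
    rw [h1, filter_union, card_union_of_disjoint, ih, Nat.filter_coprime_Ico_eq_totient]
    · ring
    · refine disjoint_filter_filter (disjoint_left.2 fun i hi hi' => ?_)
      simp only [mem_range, mem_Ico] at hi hi'
      omega

/-- Write a = g^i for a generator g. A prime dividing both t and i would make a a p-th power, so i
is coprime to rad(t), and i runs over k full periods modulo rad(t). -/
theorem binomialCount_le {F : Type} [Field F] [Finite F] {t k : ℕ}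
    (hk : Nat.card F - 1 = radical t * k) :
    binomialCount F t ≤ (radical t).totient * k := by
  obtain ⟨g, hg⟩ := IsCyclic.exists_generator (α := Fˣ)
  rw [← card_filter_coprime_range_mul, ← Set.ncard_coe_finset, binomialCount]
  refine (Set.ncard_le_ncard ?_ (Set.toFinite _)).trans
    (Set.ncard_image_le (f := fun i : ℕ => (X ^ t - C ((g ^ i : Fˣ) : F) : F[X]))
      (Finset.finite_toSet _))
  rintro f ⟨⟨a, ha, rfl⟩, hirr⟩
  obtain ⟨i, hi, hia⟩ : ∃ i < Nat.card Fˣ, g ^ i = Units.mk0 a ha := by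
    have h1 := hg (Units.mk0 a ha)
    rw [← mem_powers_iff_mem_zpowers] at h1
    obtain ⟨n, hn⟩ := h1
    refine ⟨n % Nat.card Fˣ, Nat.mod_lt _ Nat.card_pos, ?_⟩
    rw [pow_mod_natCard]
    exact hn
  refine ⟨i, ?_, by simp only [hia, Units.val_mk0]⟩
  rw [mem_coe, mem_filter, mem_range, ← hk, ← Nat.card_units]
  refine ⟨hi, Nat.coprime_of_dvd fun p hp hps hpi => ?_⟩
  obtain ⟨j, rfl⟩ := hpi
  refine pow_ne_of_irreducible_X_pow_sub_C hirr (hps.trans radical_dvd_self) hp.ne_one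
    ((g ^ j : Fˣ) : F) ?_
  have := congrArg Units.val hia
  rw [mul_comm, pow_mul] at this
  simpa using this

theorem rad4_pos (t : ℕ) : 0 < rad4 t := by
  have := Nat.radical_pos t
  unfold rad4
  split_ifs <;> omega

/-- The ratio φ(n)/n depends only on the primes dividing n, so the count with rad(t) can be restated
with rad₄(t). -/
theorem totient_rad4_mul (t : ℕ) (ht : t ≠ 0) :
    (rad4 t).totient * radical t = (radical t).totient * rad4 t := by
  unfold rad4
  split_ifs with h4
  · have h2 : 2 ∣ radical t :=
      (dvd_radical_iff_of_irreducible Nat.prime_two ht).2 (dvd_trans (by norm_num) h4)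
    rw [Nat.totient_two_mul_of_even (even_iff_two_dvd.2 h2)]
    ring
  · rfl

instance (q : ℕ) (hq : IsPrimePow q) : Finite (Fq q hq) :=
  Nat.finite_of_card_ne_zero (by rw [card_Fq]; exact hq.ne_zero)

theorem N_eq_zero {t q : ℕ} (h : ¬rad4 t ∣ q - 1) : N t q = 0 := by
  unfold N
  split_ifs with hq
  · rw [binomialCount, Set.ncard_eq_zero ?_, Set.eq_empty_iff_forall_notMem]
    · rintro f ⟨⟨a, ha, rfl⟩, hirr⟩
      have := rad4_dvd_card_sub_one_of_irreducible ha hirr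
      rw [card_Fq] at this
      exact h this
    · refine (Set.finite_range fun a : Fq q hq => (X ^ t - C a : (Fq q hq)[X])).subset ?_
      rintro f ⟨⟨a, -, rfl⟩, -⟩
      exact ⟨a, rfl⟩
  · rfl

theorem N_le {t m : ℕ} (ht : t ≠ 0) : N t (rad4 t * m + 1) ≤ (rad4 t).totient * m := by
  unfold N
  split_ifs with hq
  · have hdvd : radical t ∣ rad4 t := by
      unfold rad4
      split_ifs
      · exact dvd_mul_left _ _
      · exact dvd_rfl
    obtain ⟨k, hk⟩ := hdvd
    have h1 := binomialCount_le (F := Fq _ hq) (t := t) (k := k * m)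
      (by rw [card_Fq, Nat.add_sub_cancel, ← mul_assoc, ← hk])
    have h2 := totient_rad4_mul t ht
    refine h1.trans_eq ?_
    refine Nat.eq_of_mul_eq_mul_right (Nat.radical_pos t) ?_
    calc _ = (radical t).totient * (radical t * k) * m := by ring
      _ = (rad4 t).totient * radical t * m := by rw [← hk, ← h2]
      _ = _ := by ring
  · exact Nat.zero_le _

end IrredBinomials

end FiniteFields

/-! ### From the sieve to prime powers, and the asymptotics in X = Q/rad₄(t). -/

section PrimePowers

open Finset Filter Topology

namespace IrredBinomials

open Classical in
/-- Few `m ≤ M` are such that `r * m + 1` is a power of a small prime. -/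
theorem card_primePow_minFac_le (r R M : ℕ) :
    ((range (M + 1)).filter fun m =>
      0 < r ∧ IsPrimePow (r * m + 1) ∧ (r * m + 1).minFac ≤ R).card ≤
      R * Nat.log 2 (r * M + 1) := by
  have h : (Icc 1 R ×ˢ Icc 1 (Nat.log 2 (r * M + 1))).card = R * Nat.log 2 (r * M + 1) := by
    simp
  rw [← h]
  -- A prime power is determined by its base, at most R, and its exponent, at most log₂(rM + 1).
  refine card_le_card_of_injOn
    (fun m => ((r * m + 1).minFac, (r * m + 1).factorization (r * m + 1).minFac)) ?_ ?_
  · intro m hm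
    simp only [coe_filter, mem_range, Set.mem_ofPred_eq] at hm
    obtain ⟨hmM, -, hpp, hle⟩ := hm
    have hp := Nat.minFac_prime hpp.ne_one
    simp only [coe_product, coe_Icc, Set.mem_prod, Set.mem_Icc]
    refine ⟨⟨hp.one_le, hle⟩,
      hp.factorization_pos_of_dvd hpp.ne_zero (Nat.minFac_dvd _), ?_⟩
    refine Nat.le_log_of_pow_le (by norm_num) ?_
    calc _ ≤ (r * m + 1).minFac ^ ((r * m + 1).factorization (r * m + 1).minFac) :=
          Nat.pow_le_pow_left hp.two_le _
      _ = r * m + 1 := hpp.minFac_pow_factorization_eq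
      _ ≤ r * M + 1 := by gcongr; omega
  · intro a ha b hb hab
    simp only [coe_filter, mem_range, Set.mem_ofPred_eq] at ha hb
    simp only [Prod.mk.injEq] at hab
    have h1 := ha.2.2.1.minFac_pow_factorization_eq
    rw [hab.2, hab.1, hb.2.2.1.minFac_pow_factorization_eq] at h1
    exact (Nat.eq_of_mul_eq_mul_left ha.2.1 (by omega)).symm

open Classical in
theorem sum_primePow_le {r R : ℕ} (hr : 0 < r) (hR : 1 ≤ R) (M : ℕ) :
    ∑ m ∈ range (M + 1) with IsPrimePow (r * m + 1), (m : ℝ) ≤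
      M * (M + 1) / 2 * (1 / selbergSum r R) + 2 * M * R ^ 2 +
        M * (R * Nat.log 2 (r * M + 1)) := by
  -- If the base exceeds R the sieve applies; the remaining m are few and each contributes at most
  -- M.
  rw [← sum_filter_add_sum_filter_not _ fun m => R < (r * m + 1).minFac]
  refine add_le_add (sum_rough_le_selberg hR M _
    ((filter_subset _ _).trans (filter_subset _ _)) ?_) ?_
  · intro m hm p hp hpd
    simp only [mem_filter] at hm
    exact hm.2.trans_le (Nat.minFac_le_of_dvd hp.two_le hpd)
  · have hcard := card_primePow_minFac_le r R M
    rw [filter_filter]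
    refine (sum_le_card_nsmul _ _ (M : ℝ) ?_).trans ?_
    · intro m hm
      simp only [mem_filter, mem_range] at hm
      exact_mod_cast (by omega : m ≤ M)
    · rw [nsmul_eq_mul, mul_comm]
      gcongr
      refine le_trans ?_ (Nat.cast_le.2 hcard |>.trans_eq (Nat.cast_mul _ _))
      refine Nat.cast_le.2 (card_le_card fun m hm => ?_)
      simp only [mem_filter, not_lt] at hm ⊢
      exact ⟨hm.1, hr, hm.2⟩

open Classical in
theorem sum_N_le_totient_mul {t : ℕ} (ht : t ≠ 0) (Q : ℝ) :
    ∑ q ∈ Icc 1 ⌊Q⌋₊ with IsPrimePow q, (N t q : ℝ) ≤ (rad4 t).totient *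
      ∑ m ∈ range (⌊Q / rad4 t⌋₊ + 1) with IsPrimePow (rad4 t * m + 1), (m : ℝ) := by
  have hr := rad4_pos t
  set r := rad4 t with hrdef
  calc ∑ q ∈ Icc 1 ⌊Q⌋₊ with IsPrimePow q, (N t q : ℝ)
      = ∑ q ∈ (Icc 1 ⌊Q⌋₊).filter IsPrimePow with r ∣ q - 1, (N t q : ℝ) := by
        symm
        refine sum_filter_of_ne fun q _ hne => ?_
        by_contra hnd
        exact hne (by rw [N_eq_zero hnd, Nat.cast_zero])
    _ ≤ ∑ q ∈ ((range (⌊Q / r⌋₊ + 1)).filter fun m => IsPrimePow (r * m + 1)).image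
          (r * · + 1), (N t q : ℝ) := by
        refine sum_le_sum_of_subset_of_nonneg ?_ fun _ _ _ => Nat.cast_nonneg _
        intro q hq
        simp only [mem_filter, mem_Icc] at hq
        obtain ⟨⟨⟨h1, hQ⟩, hpp⟩, m, hm⟩ := hq
        have hqm : q = r * m + 1 := by omega
        simp only [mem_image, mem_filter, mem_range]
        refine ⟨m, ⟨?_, hqm ▸ hpp⟩, hqm.symm⟩
        rw [Nat.lt_succ_iff, Nat.floor_div_natCast, Nat.le_div_iff_mul_le hr]
        rw [mul_comm]
        omega
    _ = ∑ m ∈ range (⌊Q / r⌋₊ + 1) with IsPrimePow (r * m + 1), (N t (r * m + 1) : ℝ) :=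
        sum_image fun a _ b _ h => Nat.eq_of_mul_eq_mul_left hr (Nat.add_right_cancel h)
    _ ≤ _ := by
        rw [mul_sum]
        refine sum_le_sum fun m _ => ?_
        exact_mod_cast N_le (m := m) ht

/-- The 4 comes from n + 1 ≤ Q² and 1/ln 2 < 2. -/
theorem natLog_two_le {n : ℕ} {Q : ℝ} (hQ : 2 ≤ Q) (hn : (n : ℝ) ≤ Q) :
    (Nat.log 2 (n + 1) : ℝ) ≤ 4 * Real.log Q := by
  have h2 := Real.log_two_gt_d9
  have h1 : (2 : ℝ) ^ Nat.log 2 (n + 1) ≤ Q ^ 2 := by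
    have : 2 ^ Nat.log 2 (n + 1) ≤ n + 1 := Nat.pow_log_le_self 2 (by omega)
    have h3 : (2 : ℝ) ^ Nat.log 2 (n + 1) ≤ n + 1 := by exact_mod_cast this
    nlinarith
  have h4 := Real.log_le_log (by positivity) h1
  rw [Real.log_pow, Real.log_pow] at h4
  push_cast at h4
  have h5 : (0 : ℝ) ≤ Nat.log 2 (n + 1) := Nat.cast_nonneg _
  nlinarith

/-- The bound for the sum of `N t` in terms of `X = Q / rad₄ t` and the level `R`. -/
theorem sum_N_le {t R : ℕ} (ht : t ≠ 0) (hR : 1 ≤ R) {Q : ℝ} (hQ : 2 ≤ Q) :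
    (∑ q ∈ Icc 1 ⌊Q⌋₊ with IsPrimePow q, (N t q : ℝ)) ≤
      rad4 t * (Q / rad4 t * (Q / rad4 t + 1) / 2 / Real.log (R + 1) +
        2 * (Q / rad4 t) * R ^ 2 + Q / rad4 t * (R * (4 * Real.log Q))) := by
  classical
  have hr := rad4_pos t
  set r := rad4 t with hrdef
  have hr' : (0 : ℝ) < r := by exact_mod_cast hr
  set M := ⌊Q / r⌋₊ with hM
  have hMX : (M : ℝ) ≤ Q / r := Nat.floor_le (by positivity)
  have hG := selbergSum_pos (r := r) hR
  have hlog : 0 < Real.log (R + 1) := Real.log_pos (by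
    have : (1 : ℝ) ≤ R := by exact_mod_cast hR
    linarith)
  have hφ : (0 : ℝ) < r.totient := by exact_mod_cast Nat.totient_pos.2 hr
  have hφr : (r.totient : ℝ) ≤ r := by exact_mod_cast Nat.totient_le r
  -- The φ(r) from counting a cancels the loss r/φ(r) of the sieve.
  have hGφ : (r.totient : ℝ) * (1 / selbergSum r R) ≤ r * (1 / Real.log (R + 1)) := by
    have h := log_le_div_totient_mul_selbergSum (R := R) hr
    rw [mul_one_div, mul_one_div, div_le_div_iff₀ hG hlog]
    rw [div_mul_eq_mul_div, le_div_iff₀ hφ] at h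
    linarith
  have hK : (Nat.log 2 (r * M + 1) : ℝ) ≤ 4 * Real.log Q := by
    refine natLog_two_le hQ ?_
    rw [le_div_iff₀ hr'] at hMX
    push_cast
    linarith
  have hlogQ : 0 ≤ Real.log Q := Real.log_nonneg (by linarith)
  calc (∑ q ∈ Icc 1 ⌊Q⌋₊ with IsPrimePow q, (N t q : ℝ)) ≤ r.totient *
        ∑ m ∈ range (M + 1) with IsPrimePow (r * m + 1), (m : ℝ) := by
        convert sum_N_le_totient_mul ht Q
    _ ≤ r.totient * (M * (M + 1) / 2 * (1 / selbergSum r R) + 2 * M * R ^ 2 +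
        M * (R * Nat.log 2 (r * M + 1))) := by
        gcongr
        exact sum_primePow_le hr hR M
    _ = M * (M + 1) / 2 * (r.totient * (1 / selbergSum r R)) + r.totient * (2 * M * R ^ 2 +
        M * (R * Nat.log 2 (r * M + 1))) := by ring
    _ ≤ Q / r * (Q / r + 1) / 2 * (r * (1 / Real.log (R + 1))) + r * (2 * (Q / r) * R ^ 2 +
        Q / r * (R * (4 * Real.log Q))) := by gcongr
    _ = _ := by ring

/-- Let θ = 1/(2+δ) and divide by X²/log X. The main term tends to 1/(2θ) = 1 + δ/2 < 1 + δ; the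
errors are of order log X / X^{1-2θ} and log² X / X^{1-θ}, and vanish since θ < 1/2. -/
theorem eventually_main_bound (ε δ : ℝ) (hε : 0 < ε) (hδ : 0 < δ) :
    ∀ᶠ X : ℝ in atTop, (X * (X + 1) / 2 / (1 / (2 + δ) * Real.log X) +
      2 * X * (X ^ (1 / (2 + δ))) ^ 2 + X * (X ^ (1 / (2 + δ)) * (4 * (Real.log X / ε)))) ≤
      (1 + δ) * (X ^ 2 / Real.log X) := by
  set θ : ℝ := 1 / (2 + δ) with hθ
  have hθ0 : 0 < θ := by positivity
  have hθ1 : 2 * θ < 1 := by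
    rw [hθ, mul_one_div, div_lt_one (by linarith)]; linarith
  have hinv : 1 / (2 * θ) = 1 + δ / 2 := by rw [hθ]; field_simp
  have t1 : Tendsto (fun X : ℝ => 1 / X) atTop (𝓝 0) := tendsto_const_nhds.div_atTop tendsto_id
  have t2 : Tendsto (fun X : ℝ => Real.log X / X ^ (1 - 2 * θ)) atTop (𝓝 0) :=
    (isLittleO_log_rpow_atTop (by linarith)).tendsto_div_nhds_zero
  have t3 : Tendsto (fun X : ℝ => Real.log X ^ (2 : ℝ) / X ^ (1 - θ)) atTop (𝓝 0) :=
    (isLittleO_log_rpow_rpow_atTop 2 (by linarith)).tendsto_div_nhds_zero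
  have t4 : Tendsto (fun X : ℝ => (1 + 1 / X) * (1 / (2 * θ)) +
      2 * (Real.log X / X ^ (1 - 2 * θ)) + 4 / ε * (Real.log X ^ (2 : ℝ) / X ^ (1 - θ)))
      atTop (𝓝 ((1 + 0) * (1 / (2 * θ)) + 2 * 0 + 4 / ε * 0)) :=
    (((t1.const_add 1).mul_const _).add (t2.const_mul 2)).add (t3.const_mul _)
  have hlt : (1 + 0) * (1 / (2 * θ)) + 2 * 0 + 4 / ε * 0 < 1 + δ := by rw [hinv]; linarith
  filter_upwards [t4.eventually_lt_const hlt, eventually_gt_atTop 1] with X hX hX1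
  have hX0 : 0 < X := by linarith
  have hl : 0 < Real.log X := Real.log_pos hX1
  have e1 : X ^ (1 - 2 * θ) = X / (X ^ θ) ^ 2 := by
    rw [Real.rpow_sub hX0, Real.rpow_one, mul_comm, Real.rpow_mul hX0.le, Real.rpow_two]
  have e2 : X ^ (1 - θ) = X / X ^ θ := by rw [Real.rpow_sub hX0, Real.rpow_one]
  rw [e1, e2, Real.rpow_two] at hX
  have hθX : 0 < X ^ θ := Real.rpow_pos_of_pos hX0 _
  have := mul_le_mul_of_nonneg_right hX.le (by positivity : 0 ≤ X ^ 2 / Real.log X)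
  refine le_trans (le_of_eq ?_) this
  field_simp

end IrredBinomials

end PrimePowers

/-! ### The theorem: choice of the sieve level, uniformly in t. -/

open Classical in
theorem theorem1 (ε : ℝ) (hε : 0 < ε) (δ : ℝ) (hδ : 0 < δ) :
    ∃ Q₀ : ℝ, ∀ Q : ℝ, Q₀ ≤ Q → ∀ t : ℕ, 0 < t →
      (IrredBinomials.rad4 t : ℝ) ≤ Q ^ (1 - ε) →
      (∑ q ∈ (Finset.Icc 1 ⌊Q⌋₊).filter IsPrimePow, (IrredBinomials.N t q : ℝ)) ≤
        (1 + δ) * (Q ^ 2 /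
          ((IrredBinomials.rad4 t : ℝ) *
            IrredBinomials.tlog (Q / (IrredBinomials.rad4 t : ℝ)))) := by
  obtain ⟨X₀, hX₀⟩ := Filter.eventually_atTop.1
    ((IrredBinomials.eventually_main_bound ε δ hε hδ).and
      -- Beyond exp 2 the truncated logarithm equals ln.
      (Filter.eventually_ge_atTop (Real.exp 2)))
  obtain ⟨Q₁, hQ₁⟩ := Filter.eventually_atTop.1
    ((tendsto_rpow_atTop hε).eventually_ge_atTop X₀)
  refine ⟨max Q₁ 2, fun Q hQ t ht hrad => ?_⟩
  have hQ2 : 2 ≤ Q := (le_max_right _ _).trans hQ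
  have hQ0 : 0 < Q := by linarith
  have hQX := hQ₁ Q ((le_max_left _ _).trans hQ)
  have hr : (0 : ℝ) < IrredBinomials.rad4 t := by exact_mod_cast IrredBinomials.rad4_pos t
  set r : ℝ := (IrredBinomials.rad4 t : ℝ) with hrdef
  set X : ℝ := Q / r with hXdef
  -- This is where rad₄(t) ≤ Q^{1-ε} enters: X is large uniformly in t, and log Q ≤ (log X)/ε.
  have hεX : Q ^ ε ≤ X := by
    rw [hXdef, le_div_iff₀ hr]
    calc Q ^ ε * r ≤ Q ^ ε * Q ^ (1 - ε) := by gcongr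
      _ = Q := by rw [← Real.rpow_add hQ0, add_sub_cancel, Real.rpow_one]
  obtain ⟨hmain, hexp⟩ := hX₀ X (hQX.trans hεX)
  have hX0 : 0 < X := (Real.exp_pos 2).trans_le hexp
  have hX1 : 1 < X := (Real.one_lt_exp_iff.2 (by norm_num)).trans_le hexp
  have hlog2 : 2 ≤ Real.log X := (Real.le_log_iff_exp_le hX0).2 hexp
  have hlog0 : 0 < Real.log X := by linarith
  have hlogQ : Real.log Q ≤ Real.log X / ε := by
    rw [le_div_iff₀ hε, mul_comm, ← Real.log_rpow hQ0]
    exact Real.log_le_log (Real.rpow_pos_of_pos hQ0 _) hεX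
  have hlogQ0 : 0 ≤ Real.log Q := Real.log_nonneg (by linarith)
  have hθ : 0 < 1 / (2 + δ) := by positivity
  have hXθ : 1 ≤ X ^ (1 / (2 + δ)) := Real.one_le_rpow hX1.le hθ.le
  -- The level stays a power of X below √X, so that the error of order XR² is negligible against
  -- X²/log X.
  set R := ⌊X ^ (1 / (2 + δ))⌋₊ with hRdef
  have hR : 1 ≤ R := Nat.le_floor (by simpa using hXθ)
  have hRle : (R : ℝ) ≤ X ^ (1 / (2 + δ)) := Nat.floor_le (by linarith)
  have hlogR : 1 / (2 + δ) * Real.log X ≤ Real.log (R + 1) := by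
    rw [← Real.log_rpow hX0]
    exact Real.log_le_log (by linarith) (Nat.lt_floor_add_one _).le
  have htlog : IrredBinomials.tlog X = Real.log X := max_eq_left hlog2
  calc _ ≤ r * (X * (X + 1) / 2 / Real.log (R + 1) + 2 * X * R ^ 2 +
        X * (R * (4 * Real.log Q))) := by
        convert IrredBinomials.sum_N_le ht.ne' hR hQ2
    _ ≤ r * (X * (X + 1) / 2 / (1 / (2 + δ) * Real.log X) +
        2 * X * (X ^ (1 / (2 + δ))) ^ 2 +
        X * (X ^ (1 / (2 + δ)) * (4 * (Real.log X / ε)))) := by gcongr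
    _ ≤ r * ((1 + δ) * (X ^ 2 / Real.log X)) := by gcongr
    _ = _ := by
        rw [htlog, hXdef]
        field_simp
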